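/- **Theorem 3.1.** For a positive integer $l$ and $s,t\in\mathbb Z_l$, let $|s-t|'$ denote the cyclic distance from $s$ to $t$, i.e. the least absolute value of an integer congruent to $s-t$ modulo $l$. Let $k,l\ge 1$ and $n\ge 0$ be integers, let $f:\mathbb Z_k^n\to\mathbb Z_l$, and suppose that $$\sum_{j=1}^n \mathbb E_x\big[|f(x)-f(x\oplus e_j)|'\big]\le B,$$ where $x$ is uniformly distributed on $\mathbb Z_k^n$, $e_j$ is the $j$th unit vector and $\oplus$ is addition in $\mathbb Z_k^n$. Then for every $\epsilon>0$ there exist a non-negative integer $M$ and a function $g:\mathbb Z_k^n\to\mathbb Z_l$ such that - $g$ is an $M$-junta, i.e. there is a set $J\subseteq\{1,\dots,n\}$ with $|J|=M$ such that $g(x)$ depends only on the values $(x_j)_{j\in J}$; - $f$ is $\epsilon$-close to $g$, i.e. $\mathbb E_x\big[|f(x)-g(x)|'\big]\le\epsilon$; - $M\le l\exp(C_2Bk/\epsilon)$, where $C_2$ is an absolute constant; in fact one can take $C_2=4C_1$ with $C_1=16+8\sqrt{3\ln 2}$. -/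

import Mathlib

open scoped BigOperators

/-- The cyclic distance `|s - t|'` between two elements of `ℤ_l`: the smallest absolute value of an
integer representing `s - t`. -/
def cyclicDist {l : ℕ} (s t : ZMod l) : ℕ := (s - t).valMinAbs.natAbs

/-- The normalised `L¹`-distance `‖f - g‖₁ = 𝔼ₓ |f(x) - g(x)|'` between functions `ℤ_kⁿ → ℤ_l`,
where `x` is uniform on `ℤ_kⁿ`. -/
noncomputable def torusL1Dist {k l n : ℕ} [NeZero k] (f g : (Fin n → ZMod k) → ZMod l) : ℝ :=
  𝔼 x, (cyclicDist (f x) (g x) : ℝ)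

/-- `f` and `g` are `ε`-close. -/
def IsEpsClose {k l n : ℕ} [NeZero k] (ε : ℝ) (f g : (Fin n → ZMod k) → ZMod l) : Prop :=
  torusL1Dist f g ≤ ε

/-- The quantity `∑ⱼ 𝔼ₓ |f(x) - f(x ⊕ eⱼ)|'`, where `eⱼ` is the `j`th unit vector of `ℤ_kⁿ`. -/
noncomputable def totalCyclicInfluence {k l n : ℕ} [NeZero k]
    (f : (Fin n → ZMod k) → ZMod l) : ℝ :=
  ∑ j : Fin n, 𝔼 x, (cyclicDist (f x) (f (x + Pi.single j 1)) : ℝ)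

/-- `g` is an `M`-junta: for some set `J` of exactly `M` coordinates, `g x` depends only on the
values `x j` with `j ∈ J`. -/
def IsJunta {k l n : ℕ} (M : ℕ) (g : (Fin n → ZMod k) → ZMod l) : Prop :=
  ∃ J : Finset (Fin n), J.card = M ∧ DependsOn g (J : Set (Fin n))

/-! ### Walsh–Fourier analysis and the fourth-moment inequality. -/

namespace CubeFourier

open Finset

/-! The problem reduces to Friedgut's junta argument on the Boolean cube. The cyclic distance is
half the sum of the cut metrics of the `l` half-circle arcs (`sum_abs_arcIndicator_sub`). It
therefore suffices to approximate each `0/1` function "`f x` lies in the arc" by a junta and to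
decode the `l` approximations to a nearest point of `ℤ_l`. The arc functions have total influence `2
* totalCyclicInfluence f`, and the union of `l` juntas costs the factor `l`.

A Boolean function on the torus is pulled back to the cube by reading each coordinate as `⌊k w /
2^m⌋`, with `w` an `m`-bit integer. For large `m` this preserves expectations of nonnegative
functions up to a factor 2. Flipping bit `i` moves `w` by `2^i`, so the bit influences form a
geometric series, and each block has total influence at most `4k` times that of its coordinate,
whatever `m` is (`sum_influence_block_le`).

On the cube, Walsh weight outside `J` is either of high degree, hence bounded by the total
influence, or of low degree and touching a bit of small influence, hence small by hypercontractivity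
(`low_degree_weight_le`). Averaging over the remaining blocks and rounding gives the Boolean junta;
its size is bounded by counting bits of large influence. -/

lemma expect_add_right {G : Type*} [Fintype G] [AddGroup G] (H : G → ℝ) (a : G) :
    𝔼 x, H (x + a) = 𝔼 x, H x :=
  Fintype.expect_equiv (Equiv.addRight a) _ _ fun _ => rfl

variable {ι : Type*} [DecidableEq ι]

/-- The cube point with its `i`th bit flipped. -/
def flipBit (i : ι) (x : ι → Fin 2) : ι → Fin 2 := x + Pi.single i 1

/-- The Walsh function (character of the cube) indexed by `S`. -/
noncomputable def walsh (S : Finset ι) (x : ι → Fin 2) : ℝ := ∏ i ∈ S, (-1) ^ (x i : ℕ)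

lemma flip_apply_of_ne {i j : ι} (h : j ≠ i) (x : ι → Fin 2) : flipBit i x j = x j := by
  simp [flipBit, h]

lemma flip_flip (i : ι) (x : ι → Fin 2) : flipBit i (flipBit i x) = x := by
  have h : (1 : Fin 2) + 1 = 0 := rfl
  rw [flipBit, flipBit, add_assoc, ← Pi.single_add, h, Pi.single_zero, add_zero]

lemma neg_one_pow_flip (i : ι) (x : ι → Fin 2) :
    (-1 : ℝ) ^ (flipBit i x i : ℕ) = -(-1) ^ (x i : ℕ) := by
  have h : flipBit i x i = x i + 1 := by simp [flipBit]
  rw [h]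
  generalize x i = a
  fin_cases a
  · simp
  · have h2 : (1 : Fin 2) + 1 = 0 := rfl
    simp [h2]

lemma walsh_flip_of_notMem {i : ι} {S : Finset ι} (h : i ∉ S) (x : ι → Fin 2) :
    walsh S (flipBit i x) = walsh S x :=
  prod_congr rfl fun j hj => by
    rw [flip_apply_of_ne (fun e : j = i => h (e ▸ hj))]

lemma walsh_insert {i : ι} {S : Finset ι} (h : i ∉ S) (x : ι → Fin 2) :
    walsh (insert i S) x = (-1) ^ (x i : ℕ) * walsh S x := by
  rw [walsh, prod_insert h, walsh]

lemma walsh_flip_of_mem {i : ι} {S : Finset ι} (h : i ∈ S) (x : ι → Fin 2) :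
    walsh S (flipBit i x) = -walsh S x := by
  rw [← insert_erase h, walsh_insert (notMem_erase i S), walsh_insert (notMem_erase i S),
    neg_one_pow_flip, walsh_flip_of_notMem (notMem_erase i S), neg_mul]

lemma neg_one_pow_sq (a : ℕ) : ((-1 : ℝ) ^ a) ^ 2 = 1 := by
  rw [← pow_mul, mul_comm, pow_mul]; norm_num

variable [Fintype ι]

lemma expect_flip (i : ι) (H : (ι → Fin 2) → ℝ) : 𝔼 x, H (flipBit i x) = 𝔼 x, H x :=
  expect_add_right H _

lemma expect_eq_zero_of_flip_neg (i : ι) {H : (ι → Fin 2) → ℝ} (h : ∀ x, H (flipBit i x) = -H x) :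
    𝔼 x, H x = 0 := by
  have h1 := expect_flip i H
  simp only [h, expect_neg_distrib] at h1
  linarith

/-- Hypercontractivity: the fourth moment of a Walsh polynomial. -/
theorem expect_pow_four_le (s : Finset ι) : ∀ a : Finset ι → ℝ,
    𝔼 x, (∑ S ∈ s.powerset, a S * walsh S x) ^ 4 ≤
      (∑ S ∈ s.powerset, 3 ^ #S * a S ^ 2) ^ 2 := by
  induction s using Finset.induction_on with
  | empty =>
    intro a
    simp [walsh]
    exact le_of_eq (by ring)
  | insert i s hi ih =>
    intro a
    set g0 : (ι → Fin 2) → ℝ := fun x => ∑ S ∈ s.powerset, a S * walsh S x with hg0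
    set g1 : (ι → Fin 2) → ℝ := fun x => ∑ S ∈ s.powerset, a (insert i S) * walsh S x with hg1
    set A := ∑ S ∈ s.powerset, (3 : ℝ) ^ #S * a S ^ 2 with hA
    set B := ∑ S ∈ s.powerset, (3 : ℝ) ^ #S * a (insert i S) ^ 2 with hB
    have nm : ∀ S ∈ s.powerset, i ∉ S := fun S hS h => hi (mem_powerset.1 hS h)
    have hA0 : 0 ≤ A := sum_nonneg fun S _ => by positivity
    have hB0 : 0 ≤ B := sum_nonneg fun S _ => by positivity
    have ih0 : 𝔼 x, g0 x ^ 4 ≤ A ^ 2 := ih a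
    have ih1 : 𝔼 x, g1 x ^ 4 ≤ B ^ 2 := ih fun S => a (insert i S)
    have f0 : ∀ x, g0 (flipBit i x) = g0 x := fun x =>
      sum_congr rfl fun S hS => by rw [walsh_flip_of_notMem (nm S hS)]
    have f1 : ∀ x, g1 (flipBit i x) = g1 x := fun x =>
      sum_congr rfl fun S hS => by rw [walsh_flip_of_notMem (nm S hS)]
    have hsum : ∀ x, ∑ S ∈ (insert i s).powerset, a S * walsh S x =
        g0 x + (-1) ^ (x i : ℕ) * g1 x := by
      intro x
      rw [sum_powerset_insert hi, hg0, hg1, mul_sum]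
      congr 1
      refine sum_congr rfl fun S hS => ?_
      rw [walsh_insert (nm S hS)]; ring
    have hW : ∑ S ∈ (insert i s).powerset, (3 : ℝ) ^ #S * a S ^ 2 = A + 3 * B := by
      rw [sum_powerset_insert hi, hA, hB, mul_sum]
      congr 1
      refine sum_congr rfl fun S hS => ?_
      rw [card_insert_of_notMem (nm S hS)]; ring
    -- The terms odd in the sign of bit `i` average to zero, since `g0` and `g1` do not see that
    -- bit.
    have hodd : 𝔼 x, (-1 : ℝ) ^ (x i : ℕ) * (4 * g0 x ^ 3 * g1 x + 4 * g0 x * g1 x ^ 3) = 0 := by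
      refine expect_eq_zero_of_flip_neg i fun x => ?_
      rw [neg_one_pow_flip, f0, f1]; ring
    have hexp : ∀ x, (g0 x + (-1) ^ (x i : ℕ) * g1 x) ^ 4 =
        g0 x ^ 4 + 6 * (g0 x ^ 2 * g1 x ^ 2) + g1 x ^ 4 +
          (-1 : ℝ) ^ (x i : ℕ) * (4 * g0 x ^ 3 * g1 x + 4 * g0 x * g1 x ^ 3) := by
      intro x
      have h := neg_one_pow_sq (x i)
      generalize (-1 : ℝ) ^ (x i : ℕ) = σ at h ⊢
      linear_combination (6 * g0 x ^ 2 * g1 x ^ 2 + g1 x ^ 4 * (σ ^ 2 + 1) +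
        4 * g0 x * g1 x ^ 3 * σ) * h
    -- Cauchy–Schwarz and induction control the mixed term. The weight 3 is what makes `A² + 6AB +
    -- B² ≤ (A + 3B)²`.
    have hmix : 𝔼 x, g0 x ^ 2 * g1 x ^ 2 ≤ A * B := by
      refine le_of_sq_le_sq ?_ (by positivity)
      calc (𝔼 x, g0 x ^ 2 * g1 x ^ 2) ^ 2
          ≤ (𝔼 x, (g0 x ^ 2) ^ 2) * 𝔼 x, (g1 x ^ 2) ^ 2 := expect_mul_sq_le_sq_mul_sq _ _ _
        _ = (𝔼 x, g0 x ^ 4) * 𝔼 x, g1 x ^ 4 := by simp only [← pow_mul]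
        _ ≤ A ^ 2 * B ^ 2 := by
          refine mul_le_mul ih0 ih1 (expect_nonneg fun x _ => by positivity) (by positivity)
        _ = (A * B) ^ 2 := by ring
    simp only [hsum, hexp, hW]
    rw [expect_add_distrib, hodd, expect_add_distrib, expect_add_distrib, ← mul_expect]
    nlinarith [mul_nonneg hA0 hB0, sq_nonneg B]

/-- The Walsh coefficients of a function on the cube. -/
noncomputable def coeff (F : (ι → Fin 2) → ℝ) (S : Finset ι) : ℝ := 𝔼 x, F x * walsh S x

omit [DecidableEq ι] in
lemma sum_walsh_mul_walsh (x y : ι → Fin 2) :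
    ∑ S : Finset ι, walsh S x * walsh S y = if x = y then (2 : ℝ) ^ Fintype.card ι else 0 := by
  have h : ∑ S : Finset ι, walsh S x * walsh S y =
      ∏ i : ι, ((-1 : ℝ) ^ (x i : ℕ) * (-1) ^ (y i : ℕ) + 1) := by
    rw [prod_add_one, powerset_univ]
    simp [walsh, prod_mul_distrib]
  rw [h]
  split_ifs with hxy
  · subst hxy
    simp only [← pow_two, neg_one_pow_sq]
    norm_num [card_univ]
  · obtain ⟨i, hi⟩ := Function.ne_iff.1 hxy
    refine prod_eq_zero (mem_univ i) ?_
    generalize x i = a at hi ⊢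
    generalize y i = b at hi ⊢
    fin_cases a <;> fin_cases b <;> simp_all

/-- Parseval's identity. -/
theorem sum_coeff_sq (F : (ι → Fin 2) → ℝ) : ∑ S, coeff F S ^ 2 = 𝔼 x, F x ^ 2 := by
  have h : ∀ S, coeff F S ^ 2 = 𝔼 x, 𝔼 y, F x * F y * (walsh S x * walsh S y) := by
    intro S
    rw [pow_two, coeff, expect_mul_expect]
    refine expect_congr rfl fun x _ => expect_congr rfl fun y _ => by ring
  simp only [h]
  rw [← expect_sum_comm]
  refine expect_congr rfl fun x _ => ?_
  rw [← expect_sum_comm]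
  simp only [← mul_sum, sum_walsh_mul_walsh, mul_ite, mul_zero]
  rw [Fintype.expect_eq_sum_div_card, sum_ite_eq]
  simp
  ring

/-- The discrete derivative in direction `i`. -/
noncomputable def diff (i : ι) (F : (ι → Fin 2) → ℝ) (x : ι → Fin 2) : ℝ :=
  (F x - F (flipBit i x)) / 2

lemma coeff_diff (i : ι) (F : (ι → Fin 2) → ℝ) (S : Finset ι) :
    coeff (diff i F) S = if i ∈ S then coeff F S else 0 := by
  have h1 : coeff (diff i F) S = (coeff F S - 𝔼 x, F (flipBit i x) * walsh S x) / 2 := by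
    rw [coeff, coeff, ← expect_sub_distrib, expect_div]
    exact expect_congr rfl fun x _ => by rw [diff]; ring
  have h2 : 𝔼 x, F (flipBit i x) * walsh S x = 𝔼 x, F x * walsh S (flipBit i x) := by
    rw [← expect_flip i fun x => F x * walsh S (flipBit i x)]
    simp only [flip_flip]
  rw [h1, h2]
  split_ifs with h
  · simp only [walsh_flip_of_mem h, mul_neg, expect_neg_distrib]
    rw [← coeff]; ring
  · simp only [walsh_flip_of_notMem h]
    rw [← coeff]; ring

/-- The average of `F` over the coordinates outside `J`. -/
noncomputable def condExpect (J : Finset ι) (F : (ι → Fin 2) → ℝ) (x : ι → Fin 2) : ℝ :=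
  𝔼 z, F (J.piecewise x z)

/-- Exchanging the coordinates outside `J` of two points. -/
def exchange (J : Finset ι) :
    ((ι → Fin 2) × (ι → Fin 2)) ≃ ((ι → Fin 2) × (ι → Fin 2)) where
  toFun p := (J.piecewise p.1 p.2, J.piecewise p.2 p.1)
  invFun p := (J.piecewise p.1 p.2, J.piecewise p.2 p.1)
  left_inv p := by ext i <;> by_cases h : i ∈ J <;> simp [h]
  right_inv p := by ext i <;> by_cases h : i ∈ J <;> simp [h]

lemma expect_expect_piecewise (J : Finset ι) (H : (ι → Fin 2) → ℝ) :
    𝔼 x, 𝔼 z, H (J.piecewise x z) = 𝔼 x, H x := by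
  have h : 𝔼 p : (ι → Fin 2) × (ι → Fin 2), H (J.piecewise p.1 p.2) =
      𝔼 p : (ι → Fin 2) × (ι → Fin 2), H p.1 :=
    Fintype.expect_equiv (exchange J) _ _ fun _ => rfl
  rw [← univ_product_univ, expect_product, expect_product] at h
  simpa [Fintype.expect_const] using h

/-- A bit in `S` outside `J` flips the sign of the Walsh function but leaves the average unchanged.
-/
lemma coeff_condExpect (J : Finset ι) (F : (ι → Fin 2) → ℝ) (S : Finset ι) :
    coeff (condExpect J F) S = if S ⊆ J then coeff F S else 0 := by
  split_ifs with h
  · rw [coeff, coeff, ← expect_expect_piecewise J fun x => F x * walsh S x]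
    refine expect_congr rfl fun x _ => ?_
    rw [show condExpect J F x = 𝔼 z, F (J.piecewise x z) from rfl, expect_mul]
    refine expect_congr rfl fun z _ => ?_
    congr 1
    exact prod_congr rfl fun i hi => by rw [piecewise_eq_of_mem _ _ _ (h hi)]
  · obtain ⟨i, hiS, hiJ⟩ := not_subset.1 h
    refine expect_eq_zero_of_flip_neg i fun x => ?_
    rw [walsh_flip_of_mem hiS, mul_neg]
    congr 2
    refine expect_congr rfl fun z _ => congrArg F ?_
    ext j
    by_cases hj : j ∈ J
    · simp [hj, flip_apply_of_ne (fun e : j = i => hiJ (e ▸ hj))]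
    · simp [hj]

lemma expect_sub_condExpect_sq (J : Finset ι) (F : (ι → Fin 2) → ℝ) :
    𝔼 x, (F x - condExpect J F x) ^ 2 = ∑ S with ¬ S ⊆ J, coeff F S ^ 2 := by
  rw [← sum_coeff_sq fun x => F x - condExpect J F x, sum_filter]
  refine sum_congr rfl fun S _ => ?_
  have h : coeff (fun x => F x - condExpect J F x) S = coeff F S - coeff (condExpect J F) S := by
    simp only [coeff, sub_mul, expect_sub_distrib]
  rw [h, coeff_condExpect]
  by_cases hS : S ⊆ J <;> simp [hS]

/-- The influence of the `i`th bit. -/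
noncomputable def influence (i : ι) (F : (ι → Fin 2) → ℝ) : ℝ := 𝔼 x, |F x - F (flipBit i x)|

lemma influence_nonneg (i : ι) (F : (ι → Fin 2) → ℝ) : 0 ≤ influence i F :=
  expect_nonneg fun _ _ => abs_nonneg _

/-! ### Friedgut's argument for Boolean functions on the cube. -/

section Boolean

variable {F : (ι → Fin 2) → ℝ} (hF : ∀ x, F x = 0 ∨ F x = 1)
include hF

/-- Parseval for the derivative, whose square is a quarter of the absolute difference because `F` is
`0/1`-valued. -/
lemma sum_coeff_sq_mem (i : ι) : ∑ S with i ∈ S, coeff F S ^ 2 = influence i F / 4 := by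
  have h := sum_coeff_sq (diff i F)
  simp only [coeff_diff, ite_pow, ne_eq, OfNat.ofNat_ne_zero, not_false_eq_true, zero_pow] at h
  rw [sum_filter, h, influence, expect_div]
  refine expect_congr rfl fun x _ => ?_
  rw [diff]
  rcases hF x with h1 | h1 <;> rcases hF (flipBit i x) with h2 | h2 <;> rw [h1, h2] <;> norm_num

lemma sum_card_mul_coeff_sq :
    ∑ S, (#S : ℝ) * coeff F S ^ 2 = (∑ i, influence i F) / 4 := by
  have h : ∀ S : Finset ι, (#S : ℝ) * coeff F S ^ 2 =
      ∑ i, if i ∈ S then coeff F S ^ 2 else 0 := by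
    intro S; simp
  simp only [h]
  rw [sum_comm, sum_div]
  exact sum_congr rfl fun i _ => by rw [← sum_filter, sum_coeff_sq_mem hF]

/-- The low-degree Walsh weight on sets containing a bit of small influence is small. -/
lemma low_degree_weight_le (i : ι) (d : ℕ) :
    16 * (∑ S with i ∈ S ∧ #S ≤ d, coeff F S ^ 2) ^ 2 ≤ 9 ^ d * influence i F ^ 3 := by
  set W := ∑ S with i ∈ S ∧ #S ≤ d, coeff F S ^ 2 with hW
  set a : Finset ι → ℝ := fun S => if i ∈ S ∧ #S ≤ d then coeff F S else 0 with ha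
  set g : (ι → Fin 2) → ℝ := fun x => ∑ S, a S * walsh S x with hg
  set P := influence i F with hP
  have hW0 : 0 ≤ W := sum_nonneg fun S _ => sq_nonneg _
  have hP0 : 0 ≤ P := influence_nonneg i F
  have hWa : W = ∑ S, a S ^ 2 := by
    rw [hW, sum_filter]
    exact sum_congr rfl fun S _ => by simp only [ha]; split_ifs <;> simp
  have hg4 : 𝔼 x, g x ^ 4 ≤ (3 ^ d * W) ^ 2 := by
    have h := expect_pow_four_le (univ : Finset ι) a
    rw [powerset_univ] at h
    refine h.trans (pow_le_pow_left₀ (sum_nonneg fun S _ => by positivity) ?_ 2)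
    rw [hWa, mul_sum]
    refine sum_le_sum fun S _ => ?_
    by_cases hS : i ∈ S ∧ #S ≤ d
    · exact mul_le_mul_of_nonneg_right (pow_le_pow_right₀ (by norm_num) hS.2) (sq_nonneg _)
    · simp [ha, hS]
  -- `g` is the low-degree part of the derivative, so pairing the two gives its weight.
  have hinner : 𝔼 x, diff i F x * g x = W := by
    simp only [hg, mul_sum]
    rw [expect_sum_comm, hWa]
    refine sum_congr rfl fun S _ => ?_
    have : 𝔼 x, diff i F x * (a S * walsh S x) = a S * coeff (diff i F) S := by
      rw [coeff, mul_expect]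
      exact expect_congr rfl fun x _ => by ring
    rw [this, coeff_diff, pow_two]
    by_cases hS : i ∈ S ∧ #S ≤ d
    · simp [ha, hS]
    · simp [ha, hS]
  set A : (ι → Fin 2) → ℝ := fun x => |F x - F (flipBit i x)| with hA
  have hAsq : ∀ x, A x ^ 2 = A x := by
    intro x
    simp only [hA]
    rcases hF x with h1 | h1 <;> rcases hF (flipBit i x) with h2 | h2 <;> rw [h1, h2] <;> norm_num
  have hdA : ∀ x, diff i F x = A x * diff i F x := by
    intro x
    simp only [hA, diff]
    rcases hF x with h1 | h1 <;> rcases hF (flipBit i x) with h2 | h2 <;> rw [h1, h2] <;> norm_num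
  have hd4 : ∀ x, diff i F x ^ 2 = A x / 4 := by
    intro x
    simp only [hA, diff]
    rcases hF x with h1 | h1 <;> rcases hF (flipBit i x) with h2 | h2 <;> rw [h1, h2] <;> norm_num
  have hEA : 𝔼 x, A x = P := rfl
  -- The derivative lives on the set with indicator `A`, of measure `P`. Keeping `A` through two
  -- applications of Cauchy–Schwarz gains the powers of `P`: `W⁴ ≤ P³ 9^d W² / 16`.
  have c1 : W ^ 2 ≤ P / 4 * 𝔼 x, A x * g x ^ 2 := by
    calc W ^ 2 = (𝔼 x, diff i F x * (A x * g x)) ^ 2 := by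
          rw [← hinner]
          congr 1
          exact expect_congr rfl fun x _ => by
            conv_lhs => rw [hdA]
            ring
      _ ≤ (𝔼 x, diff i F x ^ 2) * 𝔼 x, (A x * g x) ^ 2 := expect_mul_sq_le_sq_mul_sq _ _ _
      _ = P / 4 * 𝔼 x, A x * g x ^ 2 := by
          simp only [hd4, mul_pow, hAsq]
          rw [← expect_div, hEA]
  have c2 : (𝔼 x, A x * g x ^ 2) ^ 2 ≤ P * (3 ^ d * W) ^ 2 := by
    calc (𝔼 x, A x * g x ^ 2) ^ 2
        ≤ (𝔼 x, A x ^ 2) * 𝔼 x, (g x ^ 2) ^ 2 := expect_mul_sq_le_sq_mul_sq _ _ _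
      _ = P * 𝔼 x, g x ^ 4 := by
          simp only [hAsq, ← pow_mul]
          rw [hEA]
      _ ≤ P * (3 ^ d * W) ^ 2 := mul_le_mul_of_nonneg_left hg4 hP0
  rcases hW0.eq_or_lt with h0 | hpos
  · rw [← h0]
    simp only [ne_eq, OfNat.ofNat_ne_zero, not_false_eq_true, zero_pow, mul_zero]
    positivity
  have c3 : (W ^ 2) ^ 2 ≤ P ^ 2 / 16 * (P * (3 ^ d * W) ^ 2) := by
    calc (W ^ 2) ^ 2 ≤ (P / 4 * 𝔼 x, A x * g x ^ 2) ^ 2 := pow_le_pow_left₀ (by positivity) c1 2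
      _ = P ^ 2 / 16 * (𝔼 x, A x * g x ^ 2) ^ 2 := by ring
      _ ≤ _ := mul_le_mul_of_nonneg_left c2 (by positivity)
  have h9 : (9 : ℝ) ^ d = (3 ^ d) ^ 2 := by rw [← pow_mul, mul_comm, pow_mul]; norm_num
  rw [h9]
  refine le_of_mul_le_mul_right ?_ (pow_pos hpos 2)
  nlinarith [c3]

/-- Friedgut's estimate: a Boolean function is close to its average over the bits of small
influence. -/
theorem expect_sub_condExpect_sq_le (J : Finset ι) {t : ℝ} (ht : 0 ≤ t)
    (hJ : ∀ i ∉ J, influence i F ≤ t ^ 2) (d : ℕ) :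
    𝔼 x, (F x - condExpect J F x) ^ 2 ≤
      (∑ i, influence i F) / 4 * (1 / (d + 1) + 3 ^ d * t) := by
  have hlow : ∀ i ∉ J, ∑ S with i ∈ S ∧ #S ≤ d, coeff F S ^ 2 ≤
      influence i F / 4 * (3 ^ d * t) := by
    intro i hi
    have hP0 := influence_nonneg i F
    refine le_of_sq_le_sq ?_ (by positivity)
    have h9 : (9 : ℝ) ^ d = (3 ^ d) ^ 2 := by rw [← pow_mul, mul_comm, pow_mul]; norm_num
    have h := low_degree_weight_le hF i d
    have h2 : (9 : ℝ) ^ d * influence i F ^ 3 ≤ 9 ^ d * (influence i F ^ 2 * t ^ 2) := by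
      rw [pow_succ (influence i F) 2]
      have := hJ i hi
      gcongr
    rw [h9] at h h2
    nlinarith
  rw [expect_sub_condExpect_sq]
  -- If `#S ≥ d + 1`, the factor `#S / (d + 1)` is at least 1; otherwise `S` is counted at some bit
  -- `i ∉ J`.
  calc ∑ S with ¬ S ⊆ J, coeff F S ^ 2
      ≤ ∑ S, ((#S : ℝ) * coeff F S ^ 2 * (1 / (d + 1)) +
          ∑ i with i ∉ J, if i ∈ S ∧ #S ≤ d then coeff F S ^ 2 else 0) := by
        rw [sum_filter]
        refine sum_le_sum fun S _ => ?_
        have hn : 0 ≤ ∑ i with i ∉ J, if i ∈ S ∧ #S ≤ d then coeff F S ^ 2 else 0 :=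
          sum_nonneg fun i _ => by split_ifs <;> positivity
        have hn' : 0 ≤ (#S : ℝ) * coeff F S ^ 2 * (1 / (d + 1)) := by positivity
        split_ifs with hS
        · linarith
        · rcases le_or_gt #S d with hd | hd
          · obtain ⟨i, hiS, hiJ⟩ := not_subset.1 hS
            have := single_le_sum (s := univ.filter fun i => i ∉ J)
              (f := fun i => if i ∈ S ∧ #S ≤ d then coeff F S ^ 2 else 0)
              (fun i _ => by split_ifs <;> positivity) (by simpa using hiJ : i ∈ _)
            rw [if_pos ⟨hiS, hd⟩] at this
            linarith
          · have h1 : (1 : ℝ) ≤ #S * (1 / (d + 1)) := by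
              rw [mul_one_div, le_div_iff₀ (by positivity), one_mul]
              exact_mod_cast hd
            nlinarith [sq_nonneg (coeff F S)]
    _ = (∑ i, influence i F) / 4 * (1 / (d + 1)) +
          ∑ i with i ∉ J, ∑ S with i ∈ S ∧ #S ≤ d, coeff F S ^ 2 := by
        rw [sum_add_distrib, ← sum_mul, sum_card_mul_coeff_sq hF, sum_comm]
        simp only [← sum_filter]
    _ ≤ (∑ i, influence i F) / 4 * (1 / (d + 1)) +
          ∑ i, influence i F / 4 * (3 ^ d * t) := by
        gcongr
        refine (sum_le_sum fun i hi => hlow i (by simpa using hi)).trans ?_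
        refine sum_le_sum_of_subset_of_nonneg (filter_subset _ _) fun i _ _ => ?_
        have := influence_nonneg i F
        positivity
    _ = _ := by rw [← sum_mul, ← sum_div]; ring

end Boolean

end CubeFourier
namespace TorusJunta

open Finset CubeFourier

/-! ### Quantising a long cycle onto `ℤ_k`. -/

section OneDimensional

variable {k : ℕ} [NeZero k]

/-- The quantisation `w ↦ ⌊k w / N⌋` from `{0, …, N - 1}` to `ℤ_k`. -/
def quantise (k N w : ℕ) : ZMod k := (k * w / N : ℕ)

lemma sum_range_cast (D : ZMod k → ℝ) : ∑ a ∈ range k, D (a : ZMod k) = ∑ a, D a := by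
  refine sum_nbij' (fun a => (a : ZMod k)) ZMod.val (by simp)
    (fun a _ => mem_range.2 (ZMod.val_lt a)) (fun a ha => ?_) (fun a _ => by simp) (by simp)
  exact ZMod.val_cast_of_lt (mem_range.1 ha)

/-- Since `k ≤ N`, each step of `w` advances the quantised value by 0 or 1, so one circuit crosses
each edge of the cycle `ℤ_k` once. -/
lemma sum_abs_quantise_le {N : ℕ} (hN : k ≤ N) (q : ZMod k → ℝ) :
    ∑ w ∈ range N, |q (quantise k N w) - q (quantise k N (w + 1))| ≤ ∑ a, |q a - q (a + 1)| := by
  have hk : 0 < k := NeZero.pos k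
  have hN0 : 0 < N := hk.trans_le hN
  have key : ∀ M, ∑ w ∈ range M, |q (quantise k N w) - q (quantise k N (w + 1))| ≤
      ∑ a ∈ range (k * M / N), |q (a : ZMod k) - q ((a : ZMod k) + 1)| := by
    intro M
    induction M with
    | zero => simp
    | succ M ih =>
      rw [sum_range_succ]
      have h1 : k * M / N ≤ k * (M + 1) / N := Nat.div_le_div_right (by gcongr; omega)
      have h2 : k * (M + 1) / N ≤ k * M / N + 1 := by
        rw [← Nat.add_div_right _ hN0]
        exact Nat.div_le_div_right (by rw [mul_add, mul_one]; gcongr)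
      obtain h | h : k * (M + 1) / N = k * M / N ∨ k * (M + 1) / N = k * M / N + 1 := by omega
      · simpa [quantise, h] using ih
      · rw [h, sum_range_succ]
        refine add_le_add ih (le_of_eq ?_)
        simp [quantise, h]
  refine (key N).trans (le_of_eq ?_)
  rw [Nat.mul_div_cancel _ hN0]
  exact sum_range_cast fun a => |q a - q (a + 1)|

lemma card_quantise_eq {N : ℕ} (hN : 0 < N) (b : ZMod k) :
    k * #{a : Fin N | quantise k N a = b} ≤ N + k ∧
      N ≤ k * #{a : Fin N | quantise k N a = b} + k := by
  have hk : 0 < k := NeZero.pos k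
  -- `A t = ⌈t N / k⌉` is the first `w` of quantised value at least `t`, so the fibre over `t` is
  -- `[A t, A (t + 1))`.
  set A : ℕ → ℕ := fun t => (t * N + (k - 1)) / k with hA
  have hA1 : ∀ t w, A t ≤ w ↔ t * N ≤ k * w := by
    intro t w
    rw [← Nat.lt_succ_iff, hA, Nat.div_lt_iff_lt_mul hk, Nat.succ_eq_add_one, add_mul, mul_comm w]
    omega
  have hA2 : ∀ t, t * N ≤ k * A t := fun t => (hA1 t _).1 le_rfl
  have hA3 : ∀ t, k * A t ≤ t * N + (k - 1) := fun t => Nat.mul_div_le _ _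
  set t := b.val with ht
  have htk : t < k := ZMod.val_lt b
  have hcard : #{a : Fin N | quantise k N a = b} = #(Ico (A t) (A (t + 1))) := by
    refine card_nbij (fun a => (a : ℕ)) (fun a ha => ?_) (fun a _ a' _ h => Fin.ext h)
      fun w hw => ?_
    · have h := congrArg ZMod.val (mem_filter.1 ha).2
      have hlt : k * (a : ℕ) / N < k := by
        rw [Nat.div_lt_iff_lt_mul hN]
        exact Nat.mul_lt_mul_of_pos_left a.2 hk
      rw [quantise, ZMod.val_cast_of_lt hlt, ← ht, Nat.div_eq_iff hN] at h
      simp only [coe_Ico, Set.mem_Ico]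
      rw [hA1, ← not_le, hA1, not_le, add_mul, one_mul]
      omega
    · simp only [coe_Ico, Set.mem_Ico] at hw
      rw [hA1, ← not_le, hA1, not_le] at hw
      have hwN : w < N := by
        by_contra hcon
        have h1 : (t + 1) * N ≤ k * N := Nat.mul_le_mul_right _ htk
        have h2 : k * N ≤ k * w := Nat.mul_le_mul_left _ (not_lt.1 hcon)
        omega
      refine ⟨⟨w, hwN⟩, ?_, rfl⟩
      simp only [coe_filter, mem_univ, true_and, Set.mem_ofPred_eq]
      have : k * w / N = t := by
        rw [Nat.div_eq_iff hN]
        rw [add_mul, one_mul] at hw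
        omega
      rw [quantise, this, ht, ZMod.natCast_zmod_val]
  rw [hcard, Nat.card_Ico, Nat.mul_sub]
  have e1 := hA2 t
  have e2 := hA3 t
  have e3 := hA2 (t + 1)
  have e4 := hA3 (t + 1)
  rw [add_mul, one_mul] at e3 e4
  omega

end OneDimensional

/-! ### Influences of binary digits. -/

section Bits

variable {m : ℕ}

/-- The integer with binary digits `b`. -/
def bitsVal (b : Fin m → Fin 2) : ℕ := finFunctionFinEquiv b

lemma sum_bitsVal (g : ℕ → ℝ) : ∑ b : Fin m → Fin 2, g (bitsVal b) = ∑ w ∈ range (2 ^ m), g w := by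
  rw [← Fin.sum_univ_eq_sum_range]
  exact Fintype.sum_equiv finFunctionFinEquiv _ _ fun _ => rfl

lemma bitsVal_eq_add (i : Fin m) (b : Fin m → Fin 2) :
    bitsVal b = (b i : ℕ) * 2 ^ (i : ℕ) + ∑ j ∈ univ.erase i, (b j : ℕ) * 2 ^ (j : ℕ) := by
  rw [bitsVal, finFunctionFinEquiv_apply, ← add_sum_erase _ _ (mem_univ i)]

lemma bitsVal_flip (i : Fin m) (b : Fin m → Fin 2) :
    bitsVal (flipBit i b) = bitsVal b + 2 ^ (i : ℕ) ∨ bitsVal b = bitsVal (flipBit i b) + 2 ^ (i : ℕ) := by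
  have hsum : ∑ j ∈ univ.erase i, (flipBit i b j : ℕ) * 2 ^ (j : ℕ) =
      ∑ j ∈ univ.erase i, (b j : ℕ) * 2 ^ (j : ℕ) :=
    sum_congr rfl fun j hj => by rw [flip_apply_of_ne (ne_of_mem_erase hj)]
  have hi : flipBit i b i = b i + 1 := by simp [flipBit]
  rw [bitsVal_eq_add i b, bitsVal_eq_add i (flipBit i b), hsum, hi]
  generalize b i = a
  fin_cases a
  · left; simp [add_comm]
  · right
    have h2 : (1 : Fin 2) + 1 = 0 := rfl
    simp [h2, add_comm]

lemma sum_range_add_of_periodic {N : ℕ} {D : ℕ → ℝ} (hD : ∀ w, D (w + N) = D w) (s : ℕ) :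
    ∑ w ∈ range N, D (w + s) = ∑ w ∈ range N, D w := by
  induction s with
  | zero => rfl
  | succ s ih =>
    rw [← ih]
    have h1 := sum_range_succ (fun w => D (w + s)) N
    have h2 := sum_range_succ' (fun w => D (w + s)) N
    have h3 : D (N + s) = D s := by rw [add_comm, hD]
    simp only [add_right_comm _ 1 s, zero_add] at h2
    simp only [← add_assoc]
    linarith

/-- A flip is a jump of `2^i` in one direction or the other, bounded by the variation along `2^i`
unit steps. The factor 2 covers both directions, and periodicity makes every shifted sum equal to
the full variation. -/
lemma sum_abs_flip_le {u : ℕ → ℝ} (hu : ∀ w, u (w + 2 ^ m) = u w) (i : Fin m) :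
    ∑ b : Fin m → Fin 2, |u (bitsVal b) - u (bitsVal (flipBit i b))| ≤
      2 * 2 ^ (i : ℕ) * ∑ w ∈ range (2 ^ m), |u w - u (w + 1)| := by
  set D : ℕ → ℝ := fun w => |u w - u (w + 1)| with hD
  set g : ℕ → ℝ := fun v => ∑ s ∈ range (2 ^ (i : ℕ)), D (v + s) with hg
  have hg0 : ∀ v, 0 ≤ g v := fun v => sum_nonneg fun s _ => abs_nonneg _
  have htri : ∀ v, |u v - u (v + 2 ^ (i : ℕ))| ≤ g v := by
    intro v
    have := dist_le_range_sum_dist (fun s => u (v + s)) (2 ^ (i : ℕ))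
    simpa [Real.dist_eq, hg, hD, add_assoc] using this
  have hsum : ∑ b : Fin m → Fin 2, g (bitsVal b) =
      2 ^ (i : ℕ) * ∑ w ∈ range (2 ^ m), D w := by
    rw [sum_bitsVal, hg, sum_comm]
    have hper : ∀ w, D (w + 2 ^ m) = D w := by
      intro w
      simp only [hD]
      rw [add_right_comm, hu, hu]
    simp only [sum_range_add_of_periodic hper]
    simp
  have hflip : ∑ b : Fin m → Fin 2, g (bitsVal (flipBit i b)) = ∑ b : Fin m → Fin 2, g (bitsVal b) :=
    Fintype.sum_equiv (Equiv.addRight (Pi.single i 1)) _ _ fun _ => rfl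
  calc ∑ b : Fin m → Fin 2, |u (bitsVal b) - u (bitsVal (flipBit i b))|
      ≤ ∑ b : Fin m → Fin 2, (g (bitsVal b) + g (bitsVal (flipBit i b))) := by
        refine sum_le_sum fun b _ => ?_
        rcases bitsVal_flip i b with h | h
        · rw [h]
          linarith [htri (bitsVal b), hg0 (bitsVal b + 2 ^ (i : ℕ))]
        · rw [h, abs_sub_comm]
          linarith [htri (bitsVal (flipBit i b)), hg0 (bitsVal (flipBit i b) + 2 ^ (i : ℕ))]
    _ = _ := by rw [sum_add_distrib, hflip, hsum]; ring

/-- Since `∑ 2^i < 2^m`, the bound is independent of `m`, which leaves `m` free to be taken large.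
-/
lemma sum_expect_abs_flip_le {u : ℕ → ℝ} (hu : ∀ w, u (w + 2 ^ m) = u w) :
    ∑ i, 𝔼 b : Fin m → Fin 2, |u (bitsVal b) - u (bitsVal (flipBit i b))| ≤
      2 * ∑ w ∈ range (2 ^ m), |u w - u (w + 1)| := by
  set V := ∑ w ∈ range (2 ^ m), |u w - u (w + 1)| with hV
  have hV0 : 0 ≤ V := sum_nonneg fun w _ => abs_nonneg _
  have hgeom : ∑ i : Fin m, (2 : ℝ) ^ (i : ℕ) = 2 ^ m - 1 := by
    rw [Fin.sum_univ_eq_sum_range (fun i => (2 : ℝ) ^ i), geom_sum_eq (by norm_num)]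
    norm_num
  simp only [Fintype.expect_eq_sum_div_card]
  rw [← sum_div]
  simp only [Fintype.card_pi, Fintype.card_fin, prod_const, card_univ, Nat.cast_pow,
    Nat.cast_ofNat]
  rw [div_le_iff₀ (by positivity)]
  calc _ ≤ ∑ i : Fin m, 2 * 2 ^ (i : ℕ) * V := sum_le_sum fun i _ => sum_abs_flip_le hu i
    _ = 2 * (2 ^ m - 1) * V := by rw [← sum_mul, ← mul_sum, hgeom]
    _ ≤ 2 * V * 2 ^ m := by nlinarith

end Bits

/-! ### Comparing product expectations. -/

section Density

lemma expect_comp_eq {α β : Type*} [Fintype α] [Fintype β] [DecidableEq β] {n : ℕ}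
    (φ : α → β) (H : (Fin n → β) → ℝ) :
    𝔼 v : Fin n → α, H (fun j => φ (v j)) =
      (∑ x : Fin n → β, (∏ j, (#{a | φ a = x j} : ℝ)) * H x) / (Fintype.card α : ℝ) ^ n := by
  rw [Fintype.expect_eq_sum_div_card]
  congr 1
  · rw [← sum_fiberwise univ fun (v : Fin n → α) j => φ (v j)]
    refine sum_congr rfl fun x _ => ?_
    have hc : ∀ v ∈ univ.filter (fun v : Fin n → α => (fun j => φ (v j)) = x),
        H (fun j => φ (v j)) = H x := fun v hv => congrArg H (mem_filter.1 hv).2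
    rw [sum_congr rfl hc, sum_const, nsmul_eq_mul]
    congr 1
    have hs : univ.filter (fun v : Fin n → α => (fun j => φ (v j)) = x) =
        Fintype.piFinset fun j => univ.filter fun a => φ a = x j := by
      ext v; simp [funext_iff]
    rw [hs, Fintype.card_piFinset, Nat.cast_prod]
  · simp

/-- If `φ : α → ZMod k` is nearly equidistributed, expectations over `αⁿ` and `ℤ_kⁿ` are within
a factor two of each other. -/
lemma expect_comp_le_and_le {α : Type*} [Fintype α] {k n : ℕ} [NeZero k] (φ : α → ZMod k)
    (hα : 2 * (n * k) + k ≤ Fintype.card α)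
    (hφ : ∀ b, k * #{a | φ a = b} ≤ Fintype.card α + k ∧
      Fintype.card α ≤ k * #{a | φ a = b} + k)
    {H : (Fin n → ZMod k) → ℝ} (hH : ∀ x, 0 ≤ H x) :
    𝔼 v : Fin n → α, H (fun j => φ (v j)) ≤ 2 * 𝔼 x, H x ∧
      𝔼 x, H x ≤ 2 * 𝔼 v : Fin n → α, H (fun j => φ (v j)) := by
  have hk : (0 : ℝ) < k := by exact_mod_cast NeZero.pos k
  set N : ℝ := (Fintype.card α : ℝ) with hN
  have hα' : 2 * (n * k) + k ≤ N := by rw [hN]; exact_mod_cast hα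
  have hnk : (0 : ℝ) ≤ n * k := by positivity
  have hN0 : 0 < N := by linarith
  set δ : ℝ := k / N with hδ
  have hδ0 : 0 ≤ δ := by positivity
  have hδ1 : δ ≤ 1 := by rw [hδ, div_le_one hN0]; linarith
  -- `δ` is the relative error of one fibre size. Bernoulli's inequality gives `(1 - δ)^n ≥ 1/2`,
  -- and `(1 + δ)^n (1 - δ)^n ≤ 1` then gives `(1 + δ)^n ≤ 2`.
  have hnδ : n * δ ≤ 1 / 2 := by
    rw [hδ, ← mul_div_assoc, div_le_iff₀ hN0]; linarith
  have hlow : (1 : ℝ) / 2 ≤ (1 - δ) ^ n := by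
    have h := one_add_mul_le_pow (a := -δ) (by linarith) n
    rw [← sub_eq_add_neg] at h
    linarith
  have hup : (1 + δ) ^ n ≤ 2 := by
    have h1 : (1 + δ) ^ n * (1 - δ) ^ n ≤ 1 := by
      rw [← mul_pow]
      exact pow_le_one₀ (by nlinarith) (by nlinarith)
    have h2 : 0 ≤ (1 + δ) ^ n := by positivity
    nlinarith
  set c : ZMod k → ℝ := fun b => #{a | φ a = b} with hc
  have hc1 : ∀ b, c b ≤ N / k * (1 + δ) := by
    intro b
    have h : (k : ℝ) * c b ≤ N + k := by simp only [hc, hN]; exact_mod_cast (hφ b).1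
    have e : N / k * (1 + δ) = (N + k) / k := by rw [hδ]; field_simp
    rw [e, le_div_iff₀ hk]; linarith
  have hc2 : ∀ b, N / k * (1 - δ) ≤ c b := by
    intro b
    have h : N ≤ (k : ℝ) * c b + k := by simp only [hc, hN]; exact_mod_cast (hφ b).2
    have e : N / k * (1 - δ) = (N - k) / k := by rw [hδ]; field_simp
    rw [e, div_le_iff₀ hk]; linarith
  have hp1 : ∀ x : Fin n → ZMod k, ∏ j, c (x j) ≤ (N / k) ^ n * 2 := by
    intro x
    calc ∏ j, c (x j) ≤ ∏ _j : Fin n, N / k * (1 + δ) :=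
          prod_le_prod (fun j _ => Nat.cast_nonneg _) fun j _ => hc1 _
      _ = (N / k) ^ n * (1 + δ) ^ n := by simp [mul_pow]
      _ ≤ _ := by gcongr
  have hp2 : ∀ x : Fin n → ZMod k, (N / k) ^ n * (1 / 2) ≤ ∏ j, c (x j) := by
    intro x
    calc (N / k) ^ n * (1 / 2) ≤ (N / k) ^ n * (1 - δ) ^ n := by gcongr
      _ = ∏ _j : Fin n, N / k * (1 - δ) := by simp [mul_pow]
      _ ≤ _ := prod_le_prod (fun j _ => mul_nonneg (by positivity) (by linarith))
          fun j _ => hc2 _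
  have hE : 𝔼 x, H x = (N / k) ^ n * (∑ x, H x) / N ^ n := by
    rw [Fintype.expect_eq_sum_div_card]
    simp only [Fintype.card_pi, ZMod.card, prod_const, card_univ, Fintype.card_fin, Nat.cast_pow]
    rw [div_pow]
    field_simp
  rw [expect_comp_eq, hE, ← mul_div_assoc, ← mul_div_assoc]
  constructor
  · refine div_le_div_of_nonneg_right ?_ (by positivity)
    rw [mul_sum, mul_sum]
    exact sum_le_sum fun x _ => by nlinarith [hp1 x, hH x, mul_le_mul_of_nonneg_right (hp1 x) (hH x)]
  · refine div_le_div_of_nonneg_right ?_ (by positivity)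
    rw [mul_sum, mul_sum]
    exact sum_le_sum fun x _ => by nlinarith [hp2 x, hH x, mul_le_mul_of_nonneg_right (hp2 x) (hH x)]

end Density

end TorusJunta
namespace TorusJunta

open Finset CubeFourier

/-! ### From the cube to Boolean functions on the torus. -/

section Transfer

variable {k n m : ℕ} [NeZero k]

/-- The map from bits to the discrete torus which quantises each block of `m` bits. -/
def quantiseBits (y : Fin n × Fin m → Fin 2) (j : Fin n) : ZMod k :=
  quantise k (2 ^ m) (bitsVal fun i => y (j, i))

lemma expect_quantiseBits_le_and_le (hm : 2 * (n * k) + k ≤ 2 ^ m) {H : (Fin n → ZMod k) → ℝ}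
    (hH : ∀ x, 0 ≤ H x) :
    𝔼 y : Fin n × Fin m → Fin 2, H (quantiseBits y) ≤ 2 * 𝔼 x, H x ∧
      𝔼 x, H x ≤ 2 * 𝔼 y : Fin n × Fin m → Fin 2, H (quantiseBits y) := by
  have h : 𝔼 y : Fin n × Fin m → Fin 2, H (quantiseBits y) =
      𝔼 v : Fin n → Fin (2 ^ m), H fun j => quantise k (2 ^ m) (v j) :=
    Fintype.expect_equiv
      ((Equiv.curry (Fin n) (Fin m) (Fin 2)).trans
        (Equiv.piCongrRight fun _ => finFunctionFinEquiv)) _ _ fun _ => rfl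
  rw [h]
  exact expect_comp_le_and_le (fun a : Fin (2 ^ m) => quantise k (2 ^ m) a) (by simpa using hm)
    (fun b => by simpa using card_quantise_eq (by positivity) b) hH

omit [NeZero k] in
lemma quantiseBits_piecewise (J : Finset (Fin n)) (y z : Fin n × Fin m → Fin 2) :
    (quantiseBits ((univ.filter fun p : Fin n × Fin m => p.1 ∈ J).piecewise y z) :
      Fin n → ZMod k) = J.piecewise (quantiseBits y) (quantiseBits z) := by
  ext j
  by_cases hj : j ∈ J <;> simp [quantiseBits, hj]

/-- Placing a string of bits in block `j`. -/
def blockBits (j : Fin n) (b : Fin m → Fin 2) (p : Fin n × Fin m) : Fin 2 :=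
  if p.1 = j then b p.2 else 0

lemma flipBit_add_blockBits (j : Fin n) (i : Fin m) (y : Fin n × Fin m → Fin 2)
    (b : Fin m → Fin 2) :
    flipBit (j, i) (y + blockBits j b) = y + blockBits j (flipBit i b) := by
  ext ⟨j', i'⟩
  by_cases hj : j' = j
  · subst hj
    by_cases hi : i' = i
    · subst hi; simp [flipBit, blockBits, add_assoc]
    · simp [flipBit, blockBits, hi]
  · simp [flipBit, blockBits, hj]

omit [NeZero k] in
lemma quantiseBits_add_blockBits (j : Fin n) (y : Fin n × Fin m → Fin 2) (b : Fin m → Fin 2) :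
    (quantiseBits (y + blockBits j b) : Fin n → ZMod k) =
      Function.update (quantiseBits y) j
        (quantise k (2 ^ m) (bitsVal ((fun i => y (j, i)) + b))) := by
  ext j'
  by_cases hj : j' = j
  · subst hj
    simp only [quantiseBits, Function.update_self]
    congr 2
    ext i
    simp [blockBits]
  · simp [quantiseBits, blockBits, hj]

omit [NeZero k] in
lemma quantise_add_period {N : ℕ} (hN : 0 < N) (w : ℕ) :
    quantise k N (w + N) = quantise k N w := by
  rw [quantise, quantise, mul_add, Nat.add_mul_div_right _ _ hN]
  simp

/-- The line through a uniform point has `k` edges, each of them a uniform edge in direction `j`;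
this is the source of the factor `k` in the exponent. -/
lemma expect_sum_update (f : (Fin n → ZMod k) → ℝ) (j : Fin n) :
    𝔼 x, ∑ a, |f (Function.update x j a) - f (Function.update x j (a + 1))| =
      k * 𝔼 x, |f x - f (x + Pi.single j 1)| := by
  have hup : ∀ (x : Fin n → ZMod k) (c : ZMod k),
      Function.update x j (x j + c) = x + Pi.single j c := by
    intro x c
    ext j'
    by_cases h : j' = j
    · subst h; simp
    · simp [h]
  have h : ∀ x : Fin n → ZMod k,
      ∑ a, |f (Function.update x j a) - f (Function.update x j (a + 1))| =
        ∑ c, |f (x + Pi.single j c) - f (x + Pi.single j c + Pi.single j 1)| := by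
    intro x
    refine (Fintype.sum_equiv (Equiv.addLeft (x j)) _ _ fun c => ?_).symm
    simp only [Equiv.coe_addLeft]
    rw [add_assoc (x j), hup, hup, add_assoc, ← Pi.single_add]
  simp only [h]
  rw [expect_sum_comm]
  simp only [expect_add_right fun x => |f x - f (x + Pi.single j 1)|]
  simp

/-- The bits of block `j` have total influence controlled by the influence of coordinate `j`. -/
lemma sum_influence_block_le (hm : 2 * (n * k) + k ≤ 2 ^ m) (f : (Fin n → ZMod k) → ℝ)
    (j : Fin n) :
    ∑ i : Fin m, influence (j, i) (fun y : Fin n × Fin m → Fin 2 => f (quantiseBits y)) ≤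
      4 * (k * 𝔼 x, |f x - f (x + Pi.single j 1)|) := by
  have hkm : k ≤ 2 ^ m := le_trans (Nat.le_add_left _ _) hm
  set u : (Fin n × Fin m → Fin 2) → ℕ → ℝ := fun y w =>
    f (Function.update (quantiseBits y) j (quantise k (2 ^ m) w)) with hu
  have hper : ∀ y w, u y (w + 2 ^ m) = u y w := by
    intro y w
    simp only [hu]
    rw [quantise_add_period (by positivity)]
  have hinf : ∀ i : Fin m,
      influence (j, i) (fun y : Fin n × Fin m → Fin 2 => f (quantiseBits y)) =
        𝔼 y, 𝔼 b, |u y (bitsVal b) - u y (bitsVal (flipBit i b))| := by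
    intro i
    set G : (Fin n × Fin m → Fin 2) → ℝ := fun y =>
      |f (quantiseBits y) - f (quantiseBits (flipBit (j, i) y))| with hG
    -- A uniform shift `b` of block `j` preserves the expectation and separates the bits of that
    -- block from the rest of `y`.
    calc influence (j, i) (fun y : Fin n × Fin m → Fin 2 => f (quantiseBits y))
        = 𝔼 _b : Fin m → Fin 2, 𝔼 y, G y := by rw [Fintype.expect_const]; rfl
      _ = 𝔼 b : Fin m → Fin 2, 𝔼 y, G (y + blockBits j b) := by
          simp only [expect_add_right]
      _ = 𝔼 y, 𝔼 b : Fin m → Fin 2, G (y + blockBits j b) := expect_comm _ _ _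
      _ = _ := by
          refine expect_congr rfl fun y _ => ?_
          rw [← expect_add_right (fun b => |u y (bitsVal b) - u y (bitsVal (flipBit i b))|)
            fun i => y (j, i)]
          refine expect_congr rfl fun b _ => ?_
          simp only [hG, hu, flipBit_add_blockBits, quantiseBits_add_blockBits]
          rw [add_comm b]
          simp only [flipBit, add_assoc]
  set H : (Fin n → ZMod k) → ℝ := fun x =>
    ∑ a, |f (Function.update x j a) - f (Function.update x j (a + 1))| with hH
  have hH0 : ∀ x, 0 ≤ H x := fun x => sum_nonneg fun a _ => abs_nonneg _
  have hdens := (expect_quantiseBits_le_and_le hm hH0).1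
  calc ∑ i : Fin m, influence (j, i) (fun y : Fin n × Fin m → Fin 2 => f (quantiseBits y))
      = 𝔼 y, ∑ i : Fin m, 𝔼 b, |u y (bitsVal b) - u y (bitsVal (flipBit i b))| := by
        simp only [hinf]
        rw [expect_sum_comm]
    _ ≤ 𝔼 y : Fin n × Fin m → Fin 2, 2 * H (quantiseBits y) := by
        refine expect_le_expect fun y _ => (sum_expect_abs_flip_le (hper y)).trans ?_
        exact mul_le_mul_of_nonneg_left
          (sum_abs_quantise_le hkm fun a => f (Function.update (quantiseBits y) j a)) zero_le_two
    _ = 2 * 𝔼 y : Fin n × Fin m → Fin 2, H (quantiseBits y) := by rw [← mul_expect]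
    _ ≤ 2 * (2 * 𝔼 x, H x) := by
        exact mul_le_mul_of_nonneg_left hdens zero_le_two
    _ = _ := by rw [hH, expect_sum_update]; ring

/-- Rounding to `{0, 1}` costs at most a factor four relative to the squared error. -/
lemma abs_sub_round_le {a b : ℝ} (ha : a = 0 ∨ a = 1) :
    |a - if 1 / 2 ≤ b then 1 else 0| ≤ 4 * (a - b) ^ 2 := by
  rcases ha with rfl | rfl <;> split_ifs with h
  · norm_num; nlinarith
  · norm_num; positivity
  · norm_num; positivity
  · norm_num; nlinarith

/-- `r³ / 4 ≤ e^r` and `3 ≤ e^(9/8)`, and `1 + 9/4 = 13/4`. -/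
lemma rpow_mul_cube_le {r : ℝ} (hr : 0 < r) :
    r ^ 3 / 4 * ((3 : ℝ) ^ r) ^ 2 ≤ Real.exp (13 / 4 * r) := by
  have h1 : r ^ 3 / 4 ≤ Real.exp r := by
    have h := Real.add_one_le_exp (r / 3 - 1)
    have h3 : (r / 3) ^ 3 ≤ Real.exp (r / 3 - 1) ^ 3 :=
      pow_le_pow_left₀ (by positivity) (by linarith) 3
    rw [← Real.exp_nat_mul] at h3
    have e : ((3 : ℕ) : ℝ) * (r / 3 - 1) = r - 3 := by push_cast; ring
    rw [e, Real.exp_sub] at h3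
    have h8 : (8 : ℝ) ≤ Real.exp 3 := by
      have h2 : (2 : ℝ) ≤ Real.exp 1 := by linarith [Real.add_one_le_exp (1 : ℝ)]
      have := pow_le_pow_left₀ (by norm_num) h2 3
      rw [← Real.exp_nat_mul] at this
      norm_num at this ⊢
      exact this
    rw [le_div_iff₀ (by positivity)] at h3
    have hr3 : 0 < r ^ 3 := by positivity
    nlinarith
  have h2 : ((3 : ℝ) ^ r) ^ 2 ≤ Real.exp (9 / 4 * r) := by
    have h3 : (3 : ℝ) ≤ Real.exp (9 / 8) := by
      have h := Real.exp_one_gt_d9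
      have h' := Real.add_one_le_exp (1 / 8 : ℝ)
      have e : Real.exp (9 / 8) = Real.exp 1 * Real.exp (1 / 8) := by
        rw [← Real.exp_add]; norm_num
      rw [e]
      nlinarith
    calc ((3 : ℝ) ^ r) ^ 2 ≤ (Real.exp (9 / 8) ^ r) ^ 2 := by gcongr
      _ = Real.exp (9 / 4 * r) := by
        rw [← Real.exp_mul, ← Real.exp_nat_mul]
        congr 1
        push_cast; ring
  calc r ^ 3 / 4 * ((3 : ℝ) ^ r) ^ 2 ≤ Real.exp r * Real.exp (9 / 4 * r) := by gcongr
    _ = Real.exp (13 / 4 * r) := by rw [← Real.exp_add]; ring_nf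

/-- A Friedgut-type junta theorem for Boolean functions on the discrete torus. -/
theorem exists_junta_of_boolean {f : (Fin n → ZMod k) → ℝ} (hf : ∀ x, f x = 0 ∨ f x = 1)
    {R : ℝ} (hR : 0 < R) :
    ∃ (J : Finset (Fin n)) (g : (Fin n → ZMod k) → ℝ), DependsOn g (J : Set (Fin n)) ∧
      𝔼 x, |f x - g x| ≤ k * (∑ j, 𝔼 x, |f x - f (x + Pi.single j 1)|) / R ∧
      (#J : ℝ) ≤ Real.exp (52 * R) := by
  set K := k * (∑ j, 𝔼 x, |f x - f (x + Pi.single j 1)|) with hK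
  have hK0 : 0 ≤ K := mul_nonneg (Nat.cast_nonneg _) <|
    sum_nonneg fun j _ => expect_nonneg fun x _ => abs_nonneg _
  -- If `R ≤ K`, the allowed error is at least 1 and the zero function suffices; otherwise `K < R`
  -- bounds the junta size.
  rcases le_or_gt R K with hRK | hKR
  · refine ⟨∅, fun _ => 0, fun _ _ _ => rfl, ?_, by simp [Real.exp_nonneg]⟩
    refine le_trans ?_ ((one_le_div hR).2 hRK)
    refine expect_le univ_nonempty fun x _ => ?_
    rcases hf x with h | h <;> simp [h]
  obtain ⟨m, hm⟩ : ∃ m : ℕ, 2 * (n * k) + k ≤ 2 ^ m := ⟨_, Nat.lt_two_pow_self.le⟩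
  set F : (Fin n × Fin m → Fin 2) → ℝ := fun y => f (quantiseBits y) with hF
  have hFb : ∀ y, F y = 0 ∨ F y = 1 := fun y => hf _
  have hI : ∑ p, influence p F ≤ 4 * K := by
    rw [Fintype.sum_prod_type, hK, mul_sum, mul_sum]
    exact sum_le_sum fun j _ => sum_influence_block_le hm f j
  -- With degree cutoff `⌊r⌋`, the choice of `t` makes both error terms at most `1 / r`, for a total
  -- of `8 * K * (2 / r) = K / R`.
  set r := 16 * R with hr
  have hr0 : 0 < r := by positivity
  set t := 1 / (r * (3 : ℝ) ^ r) with ht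
  have h3r : 0 < (3 : ℝ) ^ r := by positivity
  have ht0 : 0 < t := by positivity
  set J : Finset (Fin n) := univ.filter fun j => ∃ i : Fin m, t ^ 2 < influence (j, i) F with hJ
  -- Whole blocks are kept as soon as they contain one influential bit, so that the average descends
  -- to a function on the torus.
  set J' : Finset (Fin n × Fin m) := univ.filter fun p => p.1 ∈ J with hJ'
  have hinf : ∀ p ∉ J', influence p F ≤ t ^ 2 := by
    rintro ⟨j, i⟩ hp
    by_contra hcon
    exact hp (by simpa [hJ', hJ] using ⟨i, not_le.1 hcon⟩)
  set h : (Fin n → ZMod k) → ℝ := fun x =>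
    𝔼 z : Fin n × Fin m → Fin 2, f (J.piecewise x (quantiseBits z)) with hh
  have hcond : ∀ y, condExpect J' F y = h (quantiseBits y) := by
    intro y
    exact expect_congr rfl fun z _ => congrArg f (quantiseBits_piecewise J y z)
  refine ⟨J, fun x => if 1 / 2 ≤ h x then 1 else 0, ?_, ?_, ?_⟩
  · intro x x' hx
    have : h x = h x' := by
      refine expect_congr rfl fun z _ => congrArg f ?_
      exact J.piecewise_congr hx fun _ _ => rfl
    simp only [this]
  · have hd := expect_sub_condExpect_sq_le hFb J' ht0.le hinf ⌊r⌋₊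
    have hd1 : 1 / ((⌊r⌋₊ : ℝ) + 1) ≤ 1 / r :=
      one_div_le_one_div_of_le hr0 (Nat.lt_floor_add_one r).le
    have hd2 : (3 : ℝ) ^ ⌊r⌋₊ * t ≤ 1 / r := by
      have h1 : (3 : ℝ) ^ ⌊r⌋₊ ≤ 3 ^ r := by
        rw [← Real.rpow_natCast]
        exact Real.rpow_le_rpow_of_exponent_le (by norm_num) (Nat.floor_le hr0.le)
      calc (3 : ℝ) ^ ⌊r⌋₊ * t ≤ 3 ^ r * t := by gcongr
        _ = 1 / r := by rw [ht]; field_simp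
    calc 𝔼 x, |f x - if 1 / 2 ≤ h x then 1 else 0|
        ≤ 𝔼 x, 4 * (f x - h x) ^ 2 := expect_le_expect fun x _ => abs_sub_round_le (hf x)
      _ ≤ 2 * 𝔼 y : Fin n × Fin m → Fin 2, 4 * (f (quantiseBits y) - h (quantiseBits y)) ^ 2 :=
          (expect_quantiseBits_le_and_le (H := fun x => 4 * (f x - h x) ^ 2) hm
            fun x => by positivity).2
      _ = 8 * 𝔼 y, (F y - condExpect J' F y) ^ 2 := by
          simp only [hcond]
          rw [← mul_expect, ← mul_assoc]
          norm_num
          rfl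
      _ ≤ 8 * (4 * K / 4 * (1 / r + 1 / r)) := by
          gcongr
          refine hd.trans ?_
          gcongr
      _ = K / R := by rw [hr]; field_simp; ring
  · have hcard : (#J : ℝ) * t ^ 2 ≤ 4 * K := by
      set T : Finset (Fin n × Fin m) := univ.filter fun p => t ^ 2 < influence p F with hT
      have hJT : J ⊆ T.image Prod.fst := by
        intro j hj
        obtain ⟨i, hi⟩ := (mem_filter.1 hj).2
        exact mem_image.2 ⟨(j, i), by simpa [hT] using hi, rfl⟩
      have hle : (#J : ℝ) ≤ #T := by exact_mod_cast (card_le_card hJT).trans card_image_le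
      calc (#J : ℝ) * t ^ 2 ≤ #T * t ^ 2 := by gcongr
        _ = ∑ _p ∈ T, t ^ 2 := by simp
        _ ≤ ∑ p ∈ T, influence p F := sum_le_sum fun p hp => (mem_filter.1 hp).2.le
        _ ≤ ∑ p, influence p F :=
            sum_le_sum_of_subset_of_nonneg (subset_univ _) fun p _ _ => influence_nonneg p F
        _ ≤ 4 * K := hI
    have hJle : (#J : ℝ) ≤ 4 * K / t ^ 2 := (le_div_iff₀ (by positivity)).2 hcard
    calc (#J : ℝ) ≤ 4 * K / t ^ 2 := hJle
      _ ≤ 4 * R / t ^ 2 := by gcongr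
      _ = r ^ 3 / 4 * ((3 : ℝ) ^ r) ^ 2 := by rw [ht, hr]; field_simp; ring
      _ ≤ Real.exp (13 / 4 * r) := rpow_mul_cube_le hr0
      _ = Real.exp (52 * R) := by rw [hr]; ring_nf

end Transfer

/-! ### Embedding the cyclic distance by half-circle arcs. -/

section CyclicDistance

variable {l : ℕ} [NeZero l]

/-- Indicator function of the arc of length `⌊l / 2⌋` starting at `i`. -/
def arcIndicator (i s : ZMod l) : ℝ := if (s - i).val < l / 2 then 1 else 0

omit [NeZero l] in
lemma arcIndicator_eq (i s : ZMod l) : arcIndicator i s = 0 ∨ arcIndicator i s = 1 := by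
  unfold arcIndicator; split_ifs <;> simp

lemma card_arc : #{u : ZMod l | u.val < l / 2} = l / 2 := by
  have h : #{u : ZMod l | u.val < l / 2} = #(range (l / 2)) := by
    refine card_nbij' ZMod.val (fun a => (a : ZMod l)) (fun u hu => ?_) (fun a ha => ?_)
      (fun u _ => by simp) (fun a ha => ?_)
    · simpa using hu
    all_goals
      have hal : a < l := by simp at ha; omega
      simp [ZMod.val_cast_of_lt hal] at ha ⊢
      try exact ha
  rw [h, card_range]

/-- The arc can meet its translate at either end. Subtraction is truncated, and at most one term is
nonzero since `2 * (l / 2) ≤ l`. -/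
lemma card_arc_inter (d : ZMod l) :
    #{u : ZMod l | u.val < l / 2 ∧ (u + d).val < l / 2} =
      (l / 2 - d.val) + (l / 2 - (l - d.val)) := by
  have hd : d.val < l := ZMod.val_lt d
  have h : #{u : ZMod l | u.val < l / 2 ∧ (u + d).val < l / 2} =
      #(range (l / 2 - d.val) ∪ Ico (l - d.val) (l / 2)) := by
    have key : ∀ a < l, (a < l / 2 ∧ (a + d.val) % l < l / 2) ↔
        a ∈ range (l / 2 - d.val) ∪ Ico (l - d.val) (l / 2) := by
      intro a ha
      rw [mem_union, mem_range, mem_Ico]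
      rcases lt_or_ge (a + d.val) l with h | h
      · rw [Nat.mod_eq_of_lt h]; omega
      · rw [Nat.mod_eq_sub_mod h, Nat.mod_eq_of_lt (by omega)]; omega
    refine card_nbij' ZMod.val (fun a => (a : ZMod l)) (fun u hu => ?_) (fun a ha => ?_)
      (fun u _ => by simp) (fun a ha => ?_)
    · rw [mem_coe, ← key _ (ZMod.val_lt u), ← ZMod.val_add]
      simpa using hu
    · have hal : a < l := by
        simp only [coe_union, coe_range, coe_Ico, Set.mem_union, Set.mem_Iio, Set.mem_Ico] at ha
        omega
      rw [mem_coe, ← key a hal] at ha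
      simpa [ZMod.val_add, ZMod.val_cast_of_lt hal] using ha
    · have hal : a < l := by
        simp only [coe_union, coe_range, coe_Ico, Set.mem_union, Set.mem_Iio, Set.mem_Ico] at ha
        omega
      exact ZMod.val_cast_of_lt hal
  rw [h, card_union_of_disjoint, card_range, Nat.card_Ico]
  rw [disjoint_left]
  intro a ha
  rw [mem_range] at ha
  rw [mem_Ico]
  omega

/-- The cyclic distance is half the sum of the cut pseudometrics of the half-circle arcs. -/
lemma sum_abs_arcIndicator_sub (s t : ZMod l) :
    ∑ i, |arcIndicator i s - arcIndicator i t| = 2 * (cyclicDist s t : ℝ) := by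
  set d := s - t with hd
  set A : ZMod l → ℝ := fun u => if u.val < l / 2 then 1 else 0 with hA
  have h1 : ∑ i, |arcIndicator i s - arcIndicator i t| = ∑ u, |A (u + d) - A u| := by
    refine Fintype.sum_equiv (Equiv.subLeft t) _ _ fun i => ?_
    simp only [Equiv.subLeft_apply, arcIndicator, hA, hd]
    rw [show t - i + (s - t) = s - i by ring]
  have h2 : ∀ u, |A (u + d) - A u| =
      A (u + d) + A u - 2 * (if u.val < l / 2 ∧ (u + d).val < l / 2 then 1 else 0) := by
    intro u
    simp only [hA]
    by_cases ha : u.val < l / 2 <;> by_cases hb : (u + d).val < l / 2 <;> simp [ha, hb]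
    norm_num
  have h3 : ∑ u, A (u + d) = ∑ u, A u := Fintype.sum_equiv (Equiv.addRight d) _ _ fun _ => rfl
  have h4 : ∑ u, A u = (l / 2 : ℕ) := by
    simp only [hA]
    rw [sum_boole, card_arc]
  rw [h1]
  simp only [h2]
  rw [sum_sub_distrib, sum_add_distrib, h3, h4, ← mul_sum, sum_boole, card_arc_inter]
  have hdist : cyclicDist s t = min d.val (l - d.val) := ZMod.valMinAbs_natAbs_eq_min d
  have hdl : d.val < l := ZMod.val_lt d
  -- As `min d (l - d) ≤ l / 2`, also for odd `l`, the overlap is exactly `l / 2` minus the cyclic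
  -- distance.
  have hnat : l / 2 + l / 2 = 2 * cyclicDist s t + 2 * ((l / 2 - d.val) + (l / 2 - (l - d.val))) := by
    rw [hdist]; omega
  have : ((l / 2 + l / 2 : ℕ) : ℝ) =
      ((2 * cyclicDist s t + 2 * ((l / 2 - d.val) + (l / 2 - (l - d.val))) : ℕ) : ℝ) := by
    rw [hnat]
  push_cast at this ⊢
  linarith

end CyclicDistance

/-! ### Combining the arc juntas and fixing constants. -/

section Combination

variable {k l n : ℕ} [NeZero k] [NeZero l]

omit [NeZero l] in
lemma totalCyclicInfluence_nonneg (f : (Fin n → ZMod k) → ZMod l) :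
    0 ≤ totalCyclicInfluence f :=
  sum_nonneg fun _ _ => expect_nonneg fun _ _ => Nat.cast_nonneg _

/-- The arc indicators of `f` have total influence twice that of `f`. -/
lemma sum_influence_arcIndicator (f : (Fin n → ZMod k) → ZMod l) :
    ∑ i, ∑ j, 𝔼 x, |arcIndicator i (f x) - arcIndicator i (f (x + Pi.single j 1))| =
      2 * totalCyclicInfluence f := by
  rw [sum_comm, totalCyclicInfluence, mul_sum]
  refine sum_congr rfl fun j _ => ?_
  rw [← expect_sum_comm, mul_expect]
  exact expect_congr rfl fun x _ => sum_abs_arcIndicator_sub _ _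

/-- The family of arc indicators admits a nearest-point decoder. -/
lemma exists_decoder : ∃ c : (ZMod l → ℝ) → ZMod l, ∀ (v : ZMod l → ℝ) (s : ZMod l),
    (cyclicDist s (c v) : ℝ) ≤ ∑ i, |arcIndicator i s - v i| := by
  have h : ∀ v : ZMod l → ℝ, ∃ a : ZMod l, ∀ s,
      ∑ i, |arcIndicator i a - v i| ≤ ∑ i, |arcIndicator i s - v i| := by
    intro v
    obtain ⟨a, -, ha⟩ := exists_min_image univ
      (fun s : ZMod l => ∑ i, |arcIndicator i s - v i|) univ_nonempty
    exact ⟨a, fun s => ha s (mem_univ s)⟩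
  choose c hc using h
  refine ⟨c, fun v s => ?_⟩
  have h1 := sum_abs_arcIndicator_sub s (c v)
  have h2 : ∑ i, |arcIndicator i s - arcIndicator i (c v)| ≤
      ∑ i, |arcIndicator i s - v i| + ∑ i, |arcIndicator i (c v) - v i| := by
    rw [← sum_add_distrib]
    refine sum_le_sum fun i _ => (abs_sub_le _ (v i) _).trans ?_
    rw [abs_sub_comm (v i)]
  -- Minimality of `c v` doubles the error sum, which the factor 2 in the arc identity cancels.
  linarith [hc v s]

theorem exists_junta_of_totalCyclicInfluence (f : (Fin n → ZMod k) → ZMod l) {R : ℝ}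
    (hR : 0 < R) :
    ∃ (J : ZMod l → Finset (Fin n)) (g : (Fin n → ZMod k) → ZMod l),
      DependsOn g ((univ.biUnion J : Finset (Fin n)) : Set (Fin n)) ∧
      torusL1Dist f g ≤ 2 * k * totalCyclicInfluence f / R ∧
      ∀ i, (#(J i) : ℝ) ≤ Real.exp (52 * R) := by
  have h : ∀ i : ZMod l, _ := fun i =>
    exists_junta_of_boolean (f := fun x => arcIndicator i (f x)) (fun x => arcIndicator_eq i _) hR
  choose J g hdep herr hcard using h
  obtain ⟨c, hc⟩ := exists_decoder (l := l)
  refine ⟨J, fun x => c fun i => g i x, ?_, ?_, hcard⟩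
  · intro x y hxy
    refine congrArg c (funext fun i => hdep i fun j hj => hxy j ?_)
    exact mem_coe.2 (mem_biUnion.2 ⟨i, mem_univ i, hj⟩)
  · calc torusL1Dist f (fun x => c fun i => g i x)
        ≤ 𝔼 x, ∑ i, |arcIndicator i (f x) - g i x| := expect_le_expect fun x _ => hc _ _
      _ = ∑ i, 𝔼 x, |arcIndicator i (f x) - g i x| := expect_sum_comm _ _ _
      _ ≤ ∑ i, k * (∑ j, 𝔼 x, |arcIndicator i (f x) - arcIndicator i (f (x + Pi.single j 1))|) / R :=
          sum_le_sum fun i _ => herr i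
      _ = _ := by rw [← sum_div, ← mul_sum, sum_influence_arcIndicator]; ring

lemma card_biUnion_le_mul (J : ZMod l → Finset (Fin n)) {C : ℝ} (hJ : ∀ i, (#(J i) : ℝ) ≤ C) :
    (#(univ.biUnion J) : ℝ) ≤ l * C := by
  calc (#(univ.biUnion J) : ℝ) ≤ ∑ i, (#(J i) : ℝ) := by exact_mod_cast card_biUnion_le
    _ ≤ ∑ _i : ZMod l, C := sum_le_sum fun i _ => hJ i
    _ = l * C := by simp [ZMod.card]

/-- Exactly what the final exponent needs: `4 * (16 + 8 * (5/4)) = 104 = 2 * 52`. -/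
lemma le_sqrt_three_mul_log_two : (5 / 4 : ℝ) ≤ Real.sqrt (3 * Real.log 2) := by
  refine Real.le_sqrt_of_sq_le ?_
  linarith [Real.log_two_gt_d9]

end Combination

end TorusJunta

open TorusJunta in
theorem theorem3p1 (k l n : ℕ) [NeZero k] [NeZero l] (f : (Fin n → ZMod k) → ZMod l) (B ε : ℝ)
    (hB : totalCyclicInfluence f ≤ B) (hε : 0 < ε) :
    ∃ (M : ℕ) (g : (Fin n → ZMod k) → ZMod l),
      IsJunta M g ∧ IsEpsClose ε f g ∧
        (M : ℝ) ≤
          l * Real.exp (4 * (16 + 8 * Real.sqrt (3 * Real.log 2)) * B * k / ε) := by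
  have hT := totalCyclicInfluence_nonneg f
  have hk : (0 : ℝ) < k := by exact_mod_cast NeZero.pos k
  -- For `B = 0` the choice `R = 2kB/ε` degenerates. The influence then vanishes, so every positive
  -- `R` gives error 0, and `R = 1/104` gives `#(J i) ≤ e^(1/2) < 2`, hence `#(J i) ≤ 1`.
  rcases (hT.trans hB).eq_or_lt with hB0 | hB0
  · obtain ⟨J, g, hdep, herr, hcard⟩ :=
      exists_junta_of_totalCyclicInfluence f (R := 1 / 104) (by norm_num)
    have hT0 : totalCyclicInfluence f = 0 := le_antisymm (hB0 ▸ hB) hT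
    refine ⟨_, g, ⟨_, rfl, hdep⟩, ?_, card_biUnion_le_mul J fun i => ?_⟩
    · rw [hT0] at herr
      exact herr.trans (by simpa using hε.le)
    · have h2 : Real.exp (52 * (1 / 104)) < 2 := by
        refine lt_of_pow_lt_pow_left₀ 2 (by norm_num) ?_
        rw [← Real.exp_nat_mul]
        norm_num
        linarith [Real.exp_one_lt_d9]
      have h1 : (J i).card < 2 := by exact_mod_cast (hcard i).trans_lt h2
      rw [← hB0]
      simp only [mul_zero, zero_mul, zero_div, Real.exp_zero]
      exact_mod_cast Nat.lt_succ_iff.1 h1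
  · obtain ⟨J, g, hdep, herr, hcard⟩ :=
      exists_junta_of_totalCyclicInfluence f (R := 2 * k * B / ε) (by positivity)
    refine ⟨_, g, ⟨_, rfl, hdep⟩, ?_, card_biUnion_le_mul J fun i => (hcard i).trans ?_⟩
    · refine herr.trans ((div_le_iff₀ (by positivity)).2 ?_)
      rw [mul_div_cancel₀ _ hε.ne']
      gcongr
    · rw [Real.exp_le_exp, ← mul_div_assoc]
      refine div_le_div_of_nonneg_right ?_ hε.le
      have hs := le_sqrt_three_mul_log_two
      have hkB : 0 < k * B := by positivity
      nlinarith [mul_le_mul_of_nonneg_right hs hkB.le]
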